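/- Let $\alpha>2$. There is a constant $0<C_\alpha<\infty$, depending only on $\alpha$, with the following property. Let $(X,\mathcal B,\mu)$ be a non-atomic probability space, let $T:X\to X$ be an ergodic measure-preserving transformation (not necessarily invertible), and let $f,g\ge 0$ be measurable real functions on $X$ with $f\in L(\log L)^{2\alpha}$, i.e. $\int_X f\,(\log^+ f)^{2\alpha}\,d\mu<\infty$, where $\log^+ t=\max(0,\log t)$ for $t>0$ and $\log^+0=0$, and with $g\in L^1(\mu)$. Then the maximal function $$R^*(f,g)(x)=\sup_{n\ge 1}\frac{f(T^n x)\,g(T^{2n}x)}{n}$$ is finite for $\mu$-almost every $x$. Moreover, for every $\lambda>0$, $$\mu\{x: R^*(f,g)(x)>\lambda\}\le C_\alpha\left(1+\Big(\int_X f(\log^+ f)^{2\alpha}\,d\mu\Big)^{1/2}\right)\left(\frac{\|g\|_1}{\lambda}\right)^{1/2}.$$ -/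

import Mathlib

open MeasureTheory

/-- The tail maximal function of the double recurrence averages,
`R*(f, g)(x) = sup_{n ≥ 1} f(T^n x) g(T^{2n} x) / n`, as an extended real number.
The supremum contains a real term (`n = 1`), so its value is never `⊥`; it is finite
exactly when it is `< ⊤`. -/
noncomputable def tailMaximal {X : Type*} (T : X → X) (f g : X → ℝ) (x : X) : EReal :=
  ⨆ (n : ℕ) (_ : 1 ≤ n), ((f (T^[n] x) * g (T^[2 * n] x) / (n : ℝ) : ℝ) : EReal)

/-- The class `L (log L)^a` of a finite measure: `f` is a.e. (strongly) measurable and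
`∫ |f| (log⁺ |f|)^a dμ` is finite, where `log⁺ t = max 0 (log t)`. -/
def MemLLogL {X : Type*} [MeasurableSpace X] (f : X → ℝ) (a : ℝ) (μ : Measure X) : Prop :=
  AEStronglyMeasurable f μ ∧ Integrable (fun x => |f x| * (Real.posLog |f x|) ^ a) μ

/-- A measure is non-atomic if every measurable set of positive measure has a measurable
subset of strictly smaller positive measure. -/
def IsNonatomic {X : Type*} [MeasurableSpace X] (μ : Measure X) : Prop :=
  ∀ s, MeasurableSet s → 0 < μ s → ∃ t, t ⊆ s ∧ MeasurableSet t ∧ 0 < μ t ∧ μ t < μ s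

/-! Put F = 1 + f (log⁺ f)^β with β = 2α. By the maximal ergodic theorem, outside a set of measure
at most ∫F / t every Birkhoff sum of F satisfies S_n F ≤ n t. Let E be the remaining good set.

On E, cut f into dyadic levels f ~ 2^k and n into blocks N ≤ n < 2N with N = 2^j. On level k, F is
at least W_k ~ 2^k (k+1)², so an orbit from E meets that level at most 3Nt / W_k times in 3N steps.
A recurrence started at time i yields the visit times i + n and i + 2n, and this pair determines i;
hence starts are bounded by a product of visit counts (`card_orbit_recurrence_le`). Integrating
along the orbit bounds one block by a multiple of (t / W_k) N μ{g > Nθ}, with θ ~ λ / 2^k. The sum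
over j is O(‖g‖₁ / θ), and the sum over k converges because 2^k / W_k ~ (k+1)⁻².

Altogether the measure is at most ∫F / t + C t ‖g‖₁ / λ (`measure_tail_le_div_add_mul`); optimizing
in t gives the square root. -/

/-- The maximum of `0` and the first `n` nonempty Birkhoff sums of `φ`. -/
noncomputable def birkhoffMax {X : Type*} (T : X → X) (φ : X → ℝ) : ℕ → X → ℝ
  | 0 => fun _ => 0
  | n + 1 => fun x => max 0 (φ x + birkhoffMax T φ n (T x))

/-! ### Maximal ergodic theorem and weak type (1, 1) -/

section MaximalErgodic

variable {X : Type*} {T : X → X} {φ : X → ℝ}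

theorem birkhoffMax_nonneg (n : ℕ) (x : X) : 0 ≤ birkhoffMax T φ n x := by
  cases n with
  | zero => exact le_rfl
  | succ n => exact le_max_left _ _

theorem birkhoffMax_le_succ (n : ℕ) (x : X) :
    birkhoffMax T φ n x ≤ birkhoffMax T φ (n + 1) x := by
  induction n generalizing x with
  | zero => exact birkhoffMax_nonneg 1 x
  | succ n ih => exact max_le_max le_rfl (add_le_add le_rfl (ih (T x)))

theorem monotone_birkhoffMax (x : X) : Monotone fun n => birkhoffMax T φ n x :=
  monotone_nat_of_le_succ fun n => birkhoffMax_le_succ n x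

theorem birkhoffSum_le_birkhoffMax (n : ℕ) (x : X) :
    birkhoffSum T φ n x ≤ birkhoffMax T φ n x := by
  induction n generalizing x with
  | zero => exact le_of_eq (birkhoffSum_zero T φ x)
  | succ n ih =>
    rw [birkhoffSum_succ']
    exact le_max_of_le_right (add_le_add le_rfl (ih (T x)))

variable [MeasurableSpace X] {μ : Measure X}

theorem measurable_birkhoffMax (hT : Measurable T) (hφ : Measurable φ) (n : ℕ) :
    Measurable (birkhoffMax T φ n) := by
  induction n with
  | zero => exact measurable_const
  | succ n ih => exact measurable_const.max (hφ.add (ih.comp hT))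

theorem integrable_birkhoffMax (hT : MeasurePreserving T μ μ) (hφ : Integrable φ μ) (n : ℕ) :
    Integrable (birkhoffMax T φ n) μ := by
  induction n with
  | zero => exact integrable_zero _ _ _
  | succ n ih =>
    exact (integrable_zero _ _ _).sup (hφ.add (hT.integrable_comp_of_integrable ih))

/-- The maximal ergodic theorem of Hopf. -/
theorem setIntegral_birkhoffMax_pos_nonneg (hT : MeasurePreserving T μ μ) (hφm : Measurable φ)
    (hφ : Integrable φ μ) (n : ℕ) : 0 ≤ ∫ x in {x | 0 < birkhoffMax T φ n x}, φ x ∂μ := by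
  have hs : MeasurableSet {x | 0 < birkhoffMax T φ n x} :=
    measurableSet_lt measurable_const (measurable_birkhoffMax hT.measurable hφm n)
  have hi := integrable_birkhoffMax hT hφ n
  have hc := hT.integrable_comp_of_integrable hi
  rw [← integral_indicator hs]
  -- By invariance M - M ∘ T has integral zero, M being the maximal function. It is at most φ where
  -- M > 0 and at most 0 elsewhere.
  have hint : ∫ x, (birkhoffMax T φ n x - (birkhoffMax T φ n ∘ T) x) ∂μ = 0 := by
    rw [integral_sub hi hc, sub_eq_zero]
    have h := integral_map (μ := μ) (f := birkhoffMax T φ n) hT.measurable.aemeasurable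
      (by rw [hT.map_eq]; exact hi.aestronglyMeasurable)
    rwa [hT.map_eq] at h
  refine hint.ge.trans ?_
  refine integral_mono (hi.sub hc) (hφ.indicator hs) fun x => ?_
  by_cases hx : 0 < birkhoffMax T φ n x
  · simp only [Set.indicator_of_mem (show x ∈ {x | 0 < birkhoffMax T φ n x} from hx),
      Function.comp_apply]
    cases n with
    | zero => exact absurd hx (lt_irrefl _)
    | succ n =>
      have h1 : birkhoffMax T φ (n + 1) x = φ x + birkhoffMax T φ n (T x) := by
        rcases max_choice 0 (φ x + birkhoffMax T φ n (T x)) with h | h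
        · exact absurd h hx.ne'
        · exact h
      linarith [birkhoffMax_le_succ (T := T) (φ := φ) n (T x)]
  · simp only [Set.indicator_of_notMem (show x ∉ {x | 0 < birkhoffMax T φ n x} from hx),
      Function.comp_apply]
    linarith [birkhoffMax_nonneg (T := T) (φ := φ) n (T x)]

/-- The weak type `(1, 1)` inequality for ergodic averages. -/
theorem measure_exists_lt_birkhoffSum_le [IsProbabilityMeasure μ] (hT : MeasurePreserving T μ μ)
    {F : X → ℝ} (hFm : Measurable F) (hF : Integrable F μ) (hF0 : 0 ≤ F) {t : ℝ} (ht : 0 < t) :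
    μ {x | ∃ n : ℕ, n * t < birkhoffSum T F n x} ≤ ENNReal.ofReal ((∫ x, F x ∂μ) / t) := by
  set φ : X → ℝ := fun x => F x - t with hφdef
  have hφm : Measurable φ := hFm.sub_const t
  have hφ : Integrable φ μ := hF.sub (integrable_const t)
  have hsum (n : ℕ) (x : X) : birkhoffSum T φ n x = birkhoffSum T F n x - n * t := by
    simp [birkhoffSum, hφdef]
  have hsub : {x | ∃ n : ℕ, n * t < birkhoffSum T F n x} ⊆
      ⋃ n, {x | 0 < birkhoffMax T φ n x} := by
    rintro x ⟨n, hn⟩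
    refine Set.mem_iUnion.2 ⟨n, lt_of_lt_of_le ?_ (birkhoffSum_le_birkhoffMax n x)⟩
    rw [hsum]
    linarith
  refine (measure_mono hsub).trans ?_
  have hmono : Monotone fun n => {x | 0 < birkhoffMax T φ n x} := fun m n hmn x hx =>
    lt_of_lt_of_le (show 0 < birkhoffMax T φ m x from hx) (monotone_birkhoffMax x hmn)
  rw [hmono.measure_iUnion]
  refine iSup_le fun n => ?_
  have h := setIntegral_birkhoffMax_pos_nonneg hT hφm hφ n
  set s := {x | 0 < birkhoffMax T φ n x}
  rw [hφdef, integral_sub hF.integrableOn (integrable_const t), setIntegral_const,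
    smul_eq_mul] at h
  have h2 : ∫ x in s, F x ∂μ ≤ ∫ x, F x ∂μ :=
    setIntegral_le_integral hF (Filter.Eventually.of_forall hF0)
  rw [← ofReal_measureReal]
  exact ENNReal.ofReal_le_ofReal ((le_div_iff₀ ht).2 (by linarith))

end MaximalErgodic

/-! ### Counting double recurrences along an orbit -/

section Counting

variable {X : Type*} {T : X → X}

/-- The pair (i + n, i + 2n) determines i = 2(i + n) - (i + 2n), whatever n was chosen for i. Visits
to A are counted from the earliest point of P, which lies in E, so D bounds them. -/
theorem card_orbit_recurrence_le (E A G : Set X) (N D : ℕ) (x : X)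
    [DecidablePred (· ∈ A)] [DecidablePred (· ∈ G)]
    (hE : ∀ y ∈ E, ((Finset.range (3 * N)).filter fun a => T^[a] y ∈ A).card ≤ D)
    (P : Finset ℕ) (hPN : ∀ i ∈ P, i < N) (hPE : ∀ i ∈ P, T^[i] x ∈ E)
    (hP : ∀ i ∈ P, ∃ n, N ≤ n ∧ n < 2 * N ∧ T^[n] (T^[i] x) ∈ A ∧ T^[2 * n] (T^[i] x) ∈ G) :
    P.card ≤ D * ((Finset.range (5 * N)).filter fun b => T^[b] x ∈ G).card := by
  rcases P.eq_empty_or_nonempty with rfl | hne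
  · simp
  choose! n hn1 hn2 hnA hnG using hP
  set i₀ := P.min' hne
  have hi₀ : i₀ ∈ P := P.min'_mem hne
  refine le_trans ?_ (Nat.mul_le_mul_right _ (hE _ (hPE i₀ hi₀)))
  rw [← Finset.card_product]
  -- From i < N and n < 2N come the windows i + n - i₀ < 3N and i + 2n < 5N.
  refine Finset.card_le_card_of_injOn (fun i => (i + n i - i₀, i + 2 * n i)) ?_ ?_
  · intro i hi
    have hi' : i ∈ P := hi
    have h0 : i₀ ≤ i := P.min'_le i hi'
    have h1 := hPN i hi'
    have h2 := hn2 i hi'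
    have hA := hnA i hi'
    have hG := hnG i hi'
    rw [← Function.iterate_add_apply] at hA hG
    simp only [Finset.coe_product, Set.mem_prod, Finset.coe_filter, Finset.mem_range,
      Set.mem_ofPred_eq, ← Function.iterate_add_apply]
    refine ⟨⟨by omega, ?_⟩, by omega, ?_⟩
    · rwa [show i + n i - i₀ + i₀ = n i + i by omega]
    · rwa [add_comm i]
  · intro i hi j hj hij
    have h0 : i₀ ≤ i := P.min'_le i hi
    have h0' : i₀ ≤ j := P.min'_le j hj
    simp only [Prod.mk.injEq] at hij
    omega

variable [MeasurableSpace X] {μ : Measure X}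

theorem mul_measure_recurrence_le (hT : MeasurePreserving T μ μ) {E A G : Set X}
    (hEm : MeasurableSet E) (hAm : MeasurableSet A) (hGm : MeasurableSet G) (N D : ℕ)
    [DecidablePred (· ∈ A)]
    (hE : ∀ y ∈ E, ((Finset.range (3 * N)).filter fun a => T^[a] y ∈ A).card ≤ D) :
    N * μ {x | x ∈ E ∧ ∃ n, N ≤ n ∧ n < 2 * N ∧ T^[n] x ∈ A ∧ T^[2 * n] x ∈ G} ≤
      D * (5 * N) * μ G := by
  classical
  set S := {x | x ∈ E ∧ ∃ n, N ≤ n ∧ n < 2 * N ∧ T^[n] x ∈ A ∧ T^[2 * n] x ∈ G}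
  have hTm (i : ℕ) : Measurable T^[i] := hT.measurable.iterate i
  have hS : MeasurableSet S := by
    refine hEm.inter (s₂ := {x | ∃ n, N ≤ n ∧ n < 2 * N ∧ T^[n] x ∈ A ∧ T^[2 * n] x ∈ G}) ?_
    rw [Set.ofPred_exists]
    refine MeasurableSet.iUnion fun n => ?_
    exact (MeasurableSet.const _).inter ((MeasurableSet.const _).inter
      ((hTm n hAm).inter (hTm (2 * n) hGm)))
  -- By invariance, the expected number of visits to B in M steps is M μ(B).
  have key (B : Set X) (hB : MeasurableSet B) (M : ℕ) :
      ∫⁻ x, (((Finset.range M).filter fun b => T^[b] x ∈ B).card : ENNReal) ∂μ = M * μ B := by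
    have h1 (x : X) : (((Finset.range M).filter fun b => T^[b] x ∈ B).card : ENNReal) =
        ∑ b ∈ Finset.range M, (T^[b] ⁻¹' B).indicator 1 x := by
      rw [Finset.card_filter]
      push_cast
      exact Finset.sum_congr rfl fun b _ => by simp [Set.indicator_apply]
    simp_rw [h1]
    rw [lintegral_finsetSum _ fun b _ => measurable_one.indicator (hTm b hB)]
    simp_rw [lintegral_indicator_one (hTm _ hB),
      (hT.iterate _).measure_preimage hB.nullMeasurableSet]
    simp
  rw [← key S hS N, mul_assoc, show (5 * N : ENNReal) = ((5 * N : ℕ) : ENNReal) by push_cast; rfl,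
    ← key G hGm (5 * N), ← lintegral_const_mul' _ _ (ENNReal.natCast_ne_top D)]
  refine lintegral_mono fun x => ?_
  rw [← Nat.cast_mul]
  refine Nat.cast_le.2 ?_
  convert card_orbit_recurrence_le E A G N D x hE
    ((Finset.range N).filter fun b => T^[b] x ∈ S)
    (fun i hi => Finset.mem_range.1 (Finset.mem_filter.1 hi).1)
    (fun i hi => (Finset.mem_filter.1 hi).2.1) (fun i hi => (Finset.mem_filter.1 hi).2.2)

/-- Each visit to A adds at least W to a Birkhoff sum bounded by 3Nt, so D = ⌊3Nt / W⌋ is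
admissible. -/
theorem measure_recurrence_le_of_birkhoffSum_le (hT : MeasurePreserving T μ μ) {E A G : Set X}
    (hEm : MeasurableSet E) (hAm : MeasurableSet A) (hGm : MeasurableSet G) {N : ℕ} (hN : N ≠ 0)
    {F : X → ℝ} (hF0 : 0 ≤ F) {t W : ℝ} (hW : 0 < W) (hAW : ∀ x ∈ A, W ≤ F x)
    (hE : ∀ x ∈ E, ∀ n : ℕ, birkhoffSum T F n x ≤ n * t) :
    μ {x | x ∈ E ∧ ∃ n, N ≤ n ∧ n < 2 * N ∧ T^[n] x ∈ A ∧ T^[2 * n] x ∈ G} ≤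
      ENNReal.ofReal (15 * t / W) * (N * μ G) := by
  classical
  have hcard (y : X) (hy : y ∈ E) :
      ((Finset.range (3 * N)).filter fun a => T^[a] y ∈ A).card ≤ ⌊3 * N * t / W⌋₊ := by
    refine Nat.le_floor ((le_div_iff₀ hW).2 ?_)
    refine le_trans ?_ ((hE y hy (3 * N)).trans_eq (by push_cast; ring))
    rw [← nsmul_eq_mul, birkhoffSum]
    refine (Finset.card_nsmul_le_sum _ (fun a => F (T^[a] y)) W
      fun a ha => hAW _ (Finset.mem_filter.1 ha).2).trans ?_
    exact Finset.sum_le_sum_of_subset_of_nonneg (Finset.filter_subset _ _)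
      fun a _ _ => hF0 _
  have h := mul_measure_recurrence_le hT hEm hAm hGm N _ hcard
  have hN0 : (N : ENNReal) ≠ 0 := by exact_mod_cast hN
  rw [← ENNReal.mul_le_mul_iff_right hN0 (ENNReal.natCast_ne_top N)]
  refine h.trans ?_
  rcases lt_or_ge t 0 with ht | ht
  · have : ⌊3 * N * t / W⌋₊ = 0 := Nat.floor_of_nonpos
      (div_nonpos_of_nonpos_of_nonneg (mul_nonpos_of_nonneg_of_nonpos (by positivity) ht.le) hW.le)
    simp [this]
  have hfl : (⌊3 * N * t / W⌋₊ : ENNReal) ≤ ENNReal.ofReal (3 * N * t / W) := by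
    rw [← ENNReal.ofReal_natCast]
    exact ENNReal.ofReal_le_ofReal (Nat.floor_le (by positivity))
  calc (⌊3 * N * t / W⌋₊ : ENNReal) * (5 * N) * μ G
      ≤ ENNReal.ofReal (3 * N * t / W) * (5 * N) * μ G := by gcongr
    _ = N * (ENNReal.ofReal (15 * t / W) * (N * μ G)) := by
      have : ENNReal.ofReal (3 * N * t / W) * 5 = N * ENNReal.ofReal (15 * t / W) := by
        rw [← ENNReal.ofReal_natCast N, ← ENNReal.ofReal_mul (by positivity),
          show (5 : ENNReal) = ENNReal.ofReal 5 by simp, ← ENNReal.ofReal_mul (by positivity)]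
        congr 1
        ring
      rw [← mul_assoc _ (5 : ENNReal), this]
      ring

/-- The nonzero terms form a geometric progression, so their sum is less than twice the last one. -/
theorem sum_two_pow_indicator_le {θ y : ℝ} (hθ : 0 < θ) (hy : 0 ≤ y) (m : ℕ) :
    ∑ j ∈ Finset.range m, (if 2 ^ j * θ < y then (2 : ℝ) ^ j else 0) ≤ 2 * y / θ := by
  induction m with
  | zero => simp; positivity
  | succ m ih =>
    rw [Finset.sum_range_succ]
    split_ifs with h
    · have h1 : ∑ j ∈ Finset.range m, (if 2 ^ j * θ < y then (2 : ℝ) ^ j else 0) ≤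
          ∑ j ∈ Finset.range m, (2 : ℝ) ^ j :=
        Finset.sum_le_sum fun j _ => by split_ifs <;> first | exact le_rfl | positivity
      rw [geom_sum_eq (by norm_num)] at h1
      rw [le_div_iff₀ hθ]
      have h2 : (∑ j ∈ Finset.range m, (if 2 ^ j * θ < y then (2 : ℝ) ^ j else 0)) + 2 ^ m ≤
          2 * 2 ^ m := by
        norm_num at h1 ⊢
        linarith
      calc _ ≤ 2 * 2 ^ m * θ := by gcongr
        _ ≤ 2 * y := by linarith
    · simpa using ih

theorem tsum_two_pow_mul_measure_le {g : X → ℝ} (hgm : Measurable g) (hg0 : 0 ≤ g)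
    (hg : Integrable g μ) {θ : ℝ} (hθ : 0 < θ) :
    ∑' j : ℕ, (2 : ENNReal) ^ j * μ {x | 2 ^ j * θ < g x} ≤
      ENNReal.ofReal (2 * (∫ x, g x ∂μ) / θ) := by
  have hm (j : ℕ) : MeasurableSet {x | 2 ^ j * θ < g x} := measurableSet_lt measurable_const hgm
  have h1 (j : ℕ) : (2 : ENNReal) ^ j * μ {x | 2 ^ j * θ < g x} =
      ∫⁻ x, ENNReal.ofReal (if 2 ^ j * θ < g x then (2 : ℝ) ^ j else 0) ∂μ := by
    rw [← lintegral_indicator_const (hm j)]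
    refine lintegral_congr fun x => ?_
    by_cases hx : 2 ^ j * θ < g x <;> simp [hx, ENNReal.ofReal_pow]
  have h2 : ENNReal.ofReal (2 * (∫ x, g x ∂μ) / θ) = ∫⁻ x, ENNReal.ofReal (2 * g x / θ) ∂μ := by
    rw [← ofReal_integral_eq_lintegral_ofReal ((hg.const_mul 2).div_const θ)
      (Filter.Eventually.of_forall fun x => div_nonneg (mul_nonneg zero_le_two (hg0 x)) hθ.le),
      integral_div, integral_const_mul]
  rw [h2, ENNReal.tsum_eq_iSup_nat]
  refine iSup_le fun m => ?_
  simp_rw [h1]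
  rw [← lintegral_finsetSum _ fun j _ =>
    (Measurable.ite (hm j) measurable_const measurable_const).ennreal_ofReal]
  refine lintegral_mono fun x => ?_
  rw [← ENNReal.ofReal_sum_of_nonneg fun j _ => by split_ifs <;> positivity]
  exact ENNReal.ofReal_le_ofReal (sum_two_pow_indicator_le hθ (hg0 x) m)

theorem measure_tail_recurrence_le (hT : MeasurePreserving T μ μ) {E A : Set X}
    (hEm : MeasurableSet E) (hAm : MeasurableSet A)
    {F : X → ℝ} (hF0 : 0 ≤ F) {t W : ℝ} (ht : 0 ≤ t) (hW : 0 < W) (hAW : ∀ x ∈ A, W ≤ F x)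
    (hE : ∀ x ∈ E, ∀ n : ℕ, birkhoffSum T F n x ≤ n * t)
    {g : X → ℝ} (hgm : Measurable g) (hg0 : 0 ≤ g) (hg : Integrable g μ) {θ : ℝ} (hθ : 0 < θ) :
    μ {x | x ∈ E ∧ ∃ n, 1 ≤ n ∧ T^[n] x ∈ A ∧ n * θ < g (T^[2 * n] x)} ≤
      ENNReal.ofReal (30 * t * (∫ x, g x ∂μ) / (W * θ)) := by
  have hm (j : ℕ) : MeasurableSet {x | 2 ^ j * θ < g x} := measurableSet_lt measurable_const hgm
  have hsub : {x | x ∈ E ∧ ∃ n, 1 ≤ n ∧ T^[n] x ∈ A ∧ n * θ < g (T^[2 * n] x)} ⊆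
      ⋃ j : ℕ, {x | x ∈ E ∧ ∃ n, 2 ^ j ≤ n ∧ n < 2 * 2 ^ j ∧ T^[n] x ∈ A ∧
        T^[2 * n] x ∈ {x | 2 ^ j * θ < g x}} := by
    rintro x ⟨hx, n, hn, hnA, hng⟩
    have hle : 2 ^ Nat.log 2 n ≤ n := Nat.pow_log_le_self 2 (by omega)
    refine Set.mem_iUnion.2 ⟨Nat.log 2 n, hx, n, hle, ?_, hnA, lt_of_le_of_lt ?_ hng⟩
    · rw [← pow_succ']
      exact Nat.lt_pow_succ_log_self (by norm_num) n
    · have : ((2 : ℝ) ^ Nat.log 2 n) ≤ n := by exact_mod_cast hle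
      gcongr
  refine (measure_mono hsub).trans ((measure_iUnion_le _).trans ?_)
  calc _ ≤ ∑' j : ℕ, ENNReal.ofReal (15 * t / W) * (2 ^ j * μ {x | 2 ^ j * θ < g x}) := by
        refine ENNReal.tsum_le_tsum fun j => ?_
        simpa using measure_recurrence_le_of_birkhoffSum_le hT hEm hAm (hm j)
          (N := 2 ^ j) (by positivity) hF0 hW hAW hE
    _ ≤ ENNReal.ofReal (15 * t / W) * ENNReal.ofReal (2 * (∫ x, g x ∂μ) / θ) := by
        rw [ENNReal.tsum_mul_left]
        gcongr
        exact tsum_two_pow_mul_measure_le hgm hg0 hg hθ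
    _ = _ := by
        rw [← ENNReal.ofReal_mul (by positivity)]
        congr 1
        field_simp
        ring

end Counting

/-! ### Dyadic weights and optimization in t -/

/-- The logarithmic weight supplies the factor (k+1)² that makes the sum over levels converge. The
summand 1 handles k = 0, where y has no positive lower bound; the 1/4 comes from (k+1)² ≤ 4k² for k
≥ 1. -/
theorem mul_two_pow_mul_sq_le_one_add_mul_posLog_rpow {β : ℝ} (hβ : 2 ≤ β) {y : ℝ} (hy : 0 ≤ y)
    {k : ℕ} (hk : k = 0 ∨ 2 ^ k ≤ y) :
    Real.log 2 ^ β / 4 * (2 ^ k * ((k : ℝ) + 1) ^ 2) ≤ 1 + y * Real.posLog y ^ β := by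
  have hl0 : 0 < Real.log 2 := Real.log_pos one_lt_two
  have hl1 : Real.log 2 ≤ 1 := by linarith [Real.log_two_lt_d9]
  have hlβ : Real.log 2 ^ β ≤ 1 := Real.rpow_le_one hl0.le hl1 (by linarith)
  have hlβ0 : 0 < Real.log 2 ^ β := Real.rpow_pos_of_pos hl0 β
  have hp : 0 ≤ Real.posLog y ^ β := Real.rpow_nonneg Real.posLog_nonneg β
  rcases Nat.eq_zero_or_pos k with rfl | hk0
  · have := mul_nonneg hy hp
    norm_num
    linarith
  · have hky : 2 ^ k ≤ y := hk.resolve_left hk0.ne'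
    have hk1 : (1 : ℝ) ≤ k := by exact_mod_cast hk0
    have hlog : k * Real.log 2 ≤ Real.posLog y := by
      rw [← Real.log_pow]
      exact (Real.log_le_log (by positivity) hky).trans (le_max_right _ _)
    have h1 : (k : ℝ) ^ 2 * Real.log 2 ^ β ≤ Real.posLog y ^ β := by
      refine le_trans ?_ (Real.rpow_le_rpow (by positivity) hlog (by linarith))
      rw [Real.mul_rpow (by positivity) hl0.le]
      gcongr
      rw [← Real.rpow_natCast]
      exact Real.rpow_le_rpow_of_exponent_le hk1 (by exact_mod_cast hβ)
    have h2 : ((k : ℝ) + 1) ^ 2 ≤ 4 * (k : ℝ) ^ 2 := by nlinarith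
    calc Real.log 2 ^ β / 4 * (2 ^ k * ((k : ℝ) + 1) ^ 2)
        ≤ Real.log 2 ^ β / 4 * (2 ^ k * (4 * (k : ℝ) ^ 2)) := by gcongr
      _ = 2 ^ k * ((k : ℝ) ^ 2 * Real.log 2 ^ β) := by ring
      _ ≤ y * Real.posLog y ^ β := by gcongr
      _ ≤ _ := by linarith

theorem exists_dyadic_level (y : ℝ) : ∃ k : ℕ, (k = 0 ∨ 2 ^ k ≤ y) ∧ y < 2 ^ (k + 1) := by
  classical
  have h : ∃ k : ℕ, y < 2 ^ (k + 1) := by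
    obtain ⟨k, hk⟩ := pow_unbounded_of_one_lt y one_lt_two
    exact ⟨k, hk.trans_le (pow_le_pow_right₀ one_le_two k.le_succ)⟩
  refine ⟨Nat.find h, ?_, Nat.find_spec h⟩
  rcases hk : Nat.find h with _ | k
  · exact Or.inl rfl
  · exact Or.inr (not_lt.1 (Nat.find_min h (m := k) (by omega)))

theorem le_mul_sqrt_of_forall_le_div_add_mul {m a C ε : ℝ} (ha : 0 < a) (hε : 0 ≤ ε)
    (h : ∀ t : ℝ, 0 < t → m ≤ a / t + C * t * ε) : m ≤ (1 + C) * √(a * ε) := by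
  rcases hε.eq_or_lt with rfl | hε
  · simp only [mul_zero, add_zero, Real.sqrt_zero] at h ⊢
    by_contra! hm
    -- This t would give m ≤ m / 2.
    have := h (2 * a / m) (by positivity)
    field_simp at this
    linarith
  · have hsa : 0 < √a := Real.sqrt_pos.2 ha
    have hse : 0 < √ε := Real.sqrt_pos.2 hε
    -- This t makes a / t and t ε equal.
    refine (h (√a / √ε) (by positivity)).trans_eq ?_
    rw [Real.sqrt_mul ha.le]
    have h1 : a / (√a / √ε) = √a * √ε := by
      field_simp
      rw [Real.sq_sqrt ha.le]
    have h2 : √a / √ε * ε = √a * √ε := by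
      field_simp
      rw [Real.sq_sqrt hε.le]
    rw [h1, mul_assoc, h2]
    ring

/-! ### Assembling the tail estimate -/

section

variable {X : Type*} {T : X → X}

theorem setOf_lt_tailMaximal (f g : X → ℝ) (l : ℝ) :
    {x | (l : EReal) < tailMaximal T f g x} =
      {x | ∃ n : ℕ, 1 ≤ n ∧ n * l < f (T^[n] x) * g (T^[2 * n] x)} := by
  ext x
  simp only [tailMaximal, Set.mem_ofPred_eq, lt_iSup_iff, EReal.coe_lt_coe_iff, exists_prop]
  refine exists_congr fun n => and_congr_right fun hn => ?_
  rw [lt_div_iff₀ (by exact_mod_cast hn), mul_comm]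

variable [MeasurableSpace X] {μ : Measure X}

theorem measurableSet_forall_birkhoffSum_le (hT : Measurable T) {F : X → ℝ} (hF : Measurable F)
    (t : ℝ) : MeasurableSet {x | ∀ n : ℕ, birkhoffSum T F n x ≤ n * t} := by
  rw [Set.ofPred_forall]
  refine MeasurableSet.iInter fun n => measurableSet_le ?_ measurable_const
  exact Finset.measurable_sum _ fun i _ => hF.comp (hT.iterate i)

theorem measure_tail_le_div_add_mul [IsProbabilityMeasure μ] (hT : MeasurePreserving T μ μ)
    {β : ℝ} (hβ : 2 ≤ β) {f g : X → ℝ} (hfm : Measurable f) (hgm : Measurable g) (hf0 : 0 ≤ f)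
    (hg0 : 0 ≤ g) (hf : Integrable (fun x => f x * Real.posLog (f x) ^ β) μ)
    (hg : Integrable g μ) {l t : ℝ} (hl : 0 < l) (ht : 0 < t) :
    μ {x | ∃ n : ℕ, 1 ≤ n ∧ n * l < f (T^[n] x) * g (T^[2 * n] x)} ≤
      ENNReal.ofReal ((1 + ∫ x, f x * Real.posLog (f x) ^ β ∂μ) / t +
        240 * (∑' k : ℕ, 1 / ((k : ℝ) + 1) ^ 2) / Real.log 2 ^ β * t * ((∫ x, g x ∂μ) / l)) := by
  set F : X → ℝ := fun x => 1 + f x * Real.posLog (f x) ^ β with hF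
  have hc : 0 < Real.log 2 ^ β := Real.rpow_pos_of_pos (Real.log_pos one_lt_two) β
  have hG : 0 ≤ ∫ x, g x ∂μ := integral_nonneg hg0
  have hprod0 (x : X) : 0 ≤ f x * Real.posLog (f x) ^ β :=
    mul_nonneg (hf0 x) (Real.rpow_nonneg Real.posLog_nonneg β)
  have hF0 : 0 ≤ F := fun x => add_nonneg zero_le_one (hprod0 x)
  have hFm : Measurable F :=
    measurable_const.add (hfm.mul ((measurable_const.max (Real.measurable_log.comp hfm)).pow_const β))
  have hFi : Integrable F μ := (integrable_const 1).add hf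
  have hFint : ∫ x, F x ∂μ = 1 + ∫ x, f x * Real.posLog (f x) ^ β ∂μ := by
    rw [hF, integral_add (integrable_const 1) hf]
    simp
  set E : Set X := {x | ∀ n : ℕ, birkhoffSum T F n x ≤ n * t}
  set A : ℕ → Set X := fun k => {x | (k = 0 ∨ 2 ^ k ≤ f x) ∧ f x < 2 ^ (k + 1)}
  have hEm : MeasurableSet E := measurableSet_forall_birkhoffSum_le hT.measurable hFm t
  have hAm (k : ℕ) : MeasurableSet (A k) :=
    MeasurableSet.inter ((MeasurableSet.const (k = 0)).union
      (measurableSet_le measurable_const hfm)) (measurableSet_lt hfm measurable_const)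
  have hsub : {x | ∃ n : ℕ, 1 ≤ n ∧ n * l < f (T^[n] x) * g (T^[2 * n] x)} ⊆
      {x | ∃ n : ℕ, n * t < birkhoffSum T F n x} ∪ ⋃ k : ℕ,
        {x | x ∈ E ∧ ∃ n, 1 ≤ n ∧ T^[n] x ∈ A k ∧ n * (l / 2 ^ (k + 1)) < g (T^[2 * n] x)} := by
    rintro x ⟨n, hn, hx⟩
    by_cases hxE : x ∈ E
    · obtain ⟨k, hk⟩ := exists_dyadic_level (f (T^[n] x))
      refine Or.inr (Set.mem_iUnion.2 ⟨k, hxE, n, hn, hk, ?_⟩)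
      rw [← mul_div_assoc, div_lt_iff₀ (by positivity)]
      refine hx.trans_le ?_
      rw [mul_comm]
      exact mul_le_mul_of_nonneg_left hk.2.le (hg0 _)
    · obtain ⟨m, hm⟩ := not_forall.1 hxE
      exact Or.inl ⟨m, not_le.1 hm⟩
  have hsum : Summable fun k : ℕ => 1 / ((k : ℝ) + 1) ^ 2 := by
    have := (summable_nat_add_iff 1).2 (Real.summable_one_div_nat_pow.2 one_lt_two)
    exact_mod_cast this
  have hlevel (k : ℕ) :
      μ {x | x ∈ E ∧ ∃ n, 1 ≤ n ∧ T^[n] x ∈ A k ∧ n * (l / 2 ^ (k + 1)) < g (T^[2 * n] x)} ≤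
        ENNReal.ofReal (240 / Real.log 2 ^ β * t * ((∫ x, g x ∂μ) / l) *
          (1 / ((k : ℝ) + 1) ^ 2)) := by
    refine (measure_tail_recurrence_le hT hEm (hAm k) hF0 ht.le
      (W := Real.log 2 ^ β / 4 * (2 ^ k * ((k : ℝ) + 1) ^ 2)) (by positivity)
      (fun x hx => mul_two_pow_mul_sq_le_one_add_mul_posLog_rpow hβ (hf0 x) hx.1)
      (fun x hx => hx) hgm hg0 hg (by positivity)).trans_eq ?_
    congr 1
    -- 240 = 30 · 4 · 2: the constant of `measure_tail_recurrence_le`, the 1/4 in W, and 2^(k+1) /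
    -- 2^k.
    rw [pow_succ]
    field_simp
    ring
  have hS : 0 ≤ ∑' k : ℕ, 1 / ((k : ℝ) + 1) ^ 2 := tsum_nonneg fun k => by positivity
  refine (measure_mono hsub).trans ((measure_union_le _ _).trans ?_)
  rw [ENNReal.ofReal_add (div_nonneg (hFint ▸ integral_nonneg hF0) ht.le)
    (by positivity)]
  refine add_le_add ?_ ?_
  · rw [← hFint]
    exact measure_exists_lt_birkhoffSum_le hT hFm hFi hF0 ht
  · refine (measure_iUnion_le _).trans ((ENNReal.tsum_le_tsum hlevel).trans_eq ?_)
    rw [← ENNReal.ofReal_tsum_of_nonneg (fun k => by positivity) (hsum.mul_left _),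
      tsum_mul_left]
    congr 1
    ring

theorem measure_tail_le_sqrt [IsProbabilityMeasure μ] (hT : MeasurePreserving T μ μ)
    {β : ℝ} (hβ : 2 ≤ β) {f g : X → ℝ} (hfm : Measurable f) (hgm : Measurable g) (hf0 : 0 ≤ f)
    (hg0 : 0 ≤ g) (hf : Integrable (fun x => f x * Real.posLog (f x) ^ β) μ)
    (hg : Integrable g μ) {l : ℝ} (hl : 0 < l) :
    μ {x | ∃ n : ℕ, 1 ≤ n ∧ n * l < f (T^[n] x) * g (T^[2 * n] x)} ≤
      ENNReal.ofReal ((1 + 240 * (∑' k : ℕ, 1 / ((k : ℝ) + 1) ^ 2) / Real.log 2 ^ β) *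
        √((1 + ∫ x, f x * Real.posLog (f x) ^ β ∂μ) * ((∫ x, g x ∂μ) / l))) := by
  have hI : 0 ≤ ∫ x, f x * Real.posLog (f x) ^ β ∂μ := integral_nonneg fun x =>
    mul_nonneg (hf0 x) (Real.rpow_nonneg Real.posLog_nonneg β)
  have hG : 0 ≤ (∫ x, g x ∂μ) / l := div_nonneg (integral_nonneg hg0) hl.le
  rw [← ofReal_measureReal]
  refine ENNReal.ofReal_le_ofReal
    (le_mul_sqrt_of_forall_le_div_add_mul (by positivity) hG fun t ht => ?_)
  have hS : 0 ≤ ∑' k : ℕ, 1 / ((k : ℝ) + 1) ^ 2 := tsum_nonneg fun k => by positivity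
  have hc : 0 < Real.log 2 ^ β := Real.rpow_pos_of_pos (Real.log_pos one_lt_two) β
  exact ENNReal.toReal_le_of_le_ofReal (by positivity)
    (measure_tail_le_div_add_mul hT hβ hfm hgm hf0 hg0 hf hg hl ht)

theorem tailMaximal_ae_eq (hT : Measure.QuasiMeasurePreserving T μ μ) {f f' g g' : X → ℝ}
    (hf : f =ᵐ[μ] f') (hg : g =ᵐ[μ] g') : tailMaximal T f g =ᵐ[μ] tailMaximal T f' g' := by
  have h1 : ∀ᵐ x ∂μ, ∀ n : ℕ, f (T^[n] x) = f' (T^[n] x) :=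
    ae_all_iff.2 fun n => (hT.iterate n).ae hf
  have h2 : ∀ᵐ x ∂μ, ∀ n : ℕ, g (T^[n] x) = g' (T^[n] x) :=
    ae_all_iff.2 fun n => (hT.iterate n).ae hg
  filter_upwards [h1, h2] with x hx1 hx2
  simp only [tailMaximal, hx1, hx2]

theorem exists_measurable_nonneg_ae_eq {f : X → ℝ} (hf : AEMeasurable f μ) (hf0 : 0 ≤ᵐ[μ] f) :
    ∃ f' : X → ℝ, Measurable f' ∧ 0 ≤ f' ∧ f =ᵐ[μ] f' := by
  refine ⟨fun x => max (hf.mk f x) 0, hf.measurable_mk.max measurable_const,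
    fun x => le_max_right _ _, ?_⟩
  filter_upwards [hf.ae_eq_mk, hf0] with x hx hx0
  exact hx ▸ (max_eq_left hx0).symm

end

theorem theorem2 (α : ℝ) (hα : 2 < α) :
    ∃ C : ℝ, 0 < C ∧
      ∀ (X : Type*) [MeasurableSpace X] (μ : Measure X) [IsProbabilityMeasure μ]
        (T : X → X), IsNonatomic μ → Ergodic T μ →
      ∀ f g : X → ℝ, 0 ≤ᵐ[μ] f → 0 ≤ᵐ[μ] g → MemLLogL f (2 * α) μ → Integrable g μ →
        (∀ᵐ x ∂μ, tailMaximal T f g x < ⊤) ∧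
        ∀ l : ℝ, 0 < l →
          μ {x | (l : EReal) < tailMaximal T f g x} ≤
            ENNReal.ofReal
              (C * (1 + (∫ x, |f x| * (Real.posLog |f x|) ^ (2 * α) ∂μ) ^ (1 / 2 : ℝ)) *
                ((∫ x, |g x| ∂μ) / l) ^ (1 / 2 : ℝ)) := by
  have hS : 0 ≤ ∑' k : ℕ, 1 / ((k : ℝ) + 1) ^ 2 := tsum_nonneg fun k => by positivity
  have hc : 0 < Real.log 2 ^ (2 * α) := Real.rpow_pos_of_pos (Real.log_pos one_lt_two) _
  refine ⟨1 + 240 * (∑' k : ℕ, 1 / ((k : ℝ) + 1) ^ 2) / Real.log 2 ^ (2 * α), by positivity, ?_⟩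
  intro X _ μ _ T _ hT f g hf0 hg0 hf hg
  set C := 1 + 240 * (∑' k : ℕ, 1 / ((k : ℝ) + 1) ^ 2) / Real.log 2 ^ (2 * α) with hC
  have hC0 : 0 ≤ C := by positivity
  set I := ∫ x, |f x| * (Real.posLog |f x|) ^ (2 * α) ∂μ with hIdef
  have hI0 : 0 ≤ I := integral_nonneg fun x =>
    mul_nonneg (abs_nonneg _) (Real.rpow_nonneg Real.posLog_nonneg _)
  have hG0 : 0 ≤ ∫ x, |g x| ∂μ := integral_nonneg fun x => abs_nonneg _
  have hbound : ∀ l : ℝ, 0 < l → μ {x | (l : EReal) < tailMaximal T f g x} ≤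
      ENNReal.ofReal (C * (1 + I ^ (1 / 2 : ℝ)) * ((∫ x, |g x| ∂μ) / l) ^ (1 / 2 : ℝ)) := by
    intro l hl
    obtain ⟨f', hf'm, hf'0, hff'⟩ := exists_measurable_nonneg_ae_eq hf.1.aemeasurable hf0
    obtain ⟨g', hg'm, hg'0, hgg'⟩ := exists_measurable_nonneg_ae_eq hg.aemeasurable hg0
    have hfI : (fun x => |f x| * (Real.posLog |f x|) ^ (2 * α)) =ᵐ[μ]
        fun x => f' x * Real.posLog (f' x) ^ (2 * α) := by
      filter_upwards [hff'] with x hx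
      rw [hx, abs_of_nonneg (hf'0 x)]
    have hgI : (fun x => |g x|) =ᵐ[μ] g' := by
      filter_upwards [hgg'] with x hx
      rw [hx, abs_of_nonneg (hg'0 x)]
    have hset : {x | (l : EReal) < tailMaximal T f g x} =ᵐ[μ]
        {x | (l : EReal) < tailMaximal T f' g' x} := by
      filter_upwards [tailMaximal_ae_eq hT.toMeasurePreserving.quasiMeasurePreserving hff' hgg']
        with x hx
      exact congrArg (fun y => (l : EReal) < y) hx
    rw [measure_congr hset, setOf_lt_tailMaximal]
    refine (measure_tail_le_sqrt hT.toMeasurePreserving (β := 2 * α) (by linarith) hf'm hg'm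
      hf'0 hg'0 (hf.2.congr hfI) (hg.congr hgg') hl).trans (ENNReal.ofReal_le_ofReal ?_)
    rw [← integral_congr_ae hfI, ← integral_congr_ae hgI, ← hIdef, ← hC,
      Real.sqrt_mul (by positivity), ← Real.sqrt_eq_rpow, ← Real.sqrt_eq_rpow, ← mul_assoc]
    gcongr
    -- What remains is √(1 + I) ≤ 1 + √I, checked after squaring.
    rw [Real.sqrt_le_left (by positivity)]
    nlinarith [Real.sq_sqrt hI0, Real.sqrt_nonneg I]
  refine ⟨?_, hbound⟩
  -- The set where the maximal function is infinite lies in every superlevel set, so its measure is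
  -- below a bound vanishing as l → ∞.
  have hlim : Filter.Tendsto (fun l : ℝ => ENNReal.ofReal
      (C * (1 + I ^ (1 / 2 : ℝ)) * ((∫ x, |g x| ∂μ) / l) ^ (1 / 2 : ℝ))) Filter.atTop (nhds 0) := by
    have h1 : Filter.Tendsto (fun l : ℝ => ((∫ x, |g x| ∂μ) / l) ^ (1 / 2 : ℝ))
        Filter.atTop (nhds (0 ^ (1 / 2 : ℝ))) :=
      (tendsto_const_nhds.div_atTop Filter.tendsto_id).rpow_const (Or.inr (by norm_num))
    rw [Real.zero_rpow (by norm_num)] at h1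
    simpa using ENNReal.tendsto_ofReal (h1.const_mul (C * (1 + I ^ (1 / 2 : ℝ))))
  refine measure_mono_null (t := {x | tailMaximal T f g x = ⊤})
    (fun x hx => not_lt_top_iff.1 hx) ?_
  refine le_antisymm (ge_of_tendsto hlim ?_) zero_le
  filter_upwards [Filter.eventually_gt_atTop 0] with l hl
  refine (measure_mono fun x hx => ?_).trans (hbound l hl)
  have hx' : tailMaximal T f g x = ⊤ := hx
  rw [Set.mem_ofPred_eq, hx']
  exact EReal.coe_lt_top l
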